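/- Let $\mathcal{A}$ be a semi-abelian category (pointed, Barr exact, Bourn protomodular, with binary coproducts) with enough projectives: every object $A$ admits a projective presentation, that is, a regular epimorphism $F\to A$ whose domain $F$ is projective with respect to regular epimorphisms. Let $\mathcal{B}$ be a Birkhoff subcategory of $\mathcal{A}$ (full, reflective, closed under subobjects and regular quotients), with reflector $I\colon\mathcal{A}\to\mathcal{B}$ and unit $\eta$, and suppose that $\mathcal{B}$ contains the subcategory $\mathsf{Ab}(\mathcal{A})$ of all objects that admit an internal abelian group structure. An extension is a regular epimorphism. For a Birkhoff subcategory $\mathcal{X}$ of $\mathcal{A}$, an extension is $\mathcal{X}$-trivial if the naturality square of the unit of the reflection to $\mathcal{X}$ at this extension is a pullback; an extension $f\colon B\to A$ is $\mathcal{X}$-central if its pullback along some extension $g\colon C\to A$ is $\mathcal{X}$-trivial; an object is $\mathcal{X}$-perfect if its reflection in $\mathcal{X}$ is zero. An $\mathcal{X}$-central extension $u\colon U\to A$ is universal if for every $\mathcal{X}$-central extension $f\colon B\to A$ there is a unique morphism $\overline{f}\colon U\to B$ with $f\circ\overline{f}=u$. Assume that $\mathcal{A}$ satisfies condition (UCE):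 whenever $f\colon B\to A$ and $g\colon C\to B$ are $\mathsf{Ab}(\mathcal{A})$-central extensions and $B$ is $\mathsf{Ab}(\mathcal{A})$-perfect, the composite $f\circ g$ is $\mathsf{Ab}(\mathcal{A})$-central. For an object $U$ put $H_1(U,\mathcal{B})=I(U)$ and $$H_2(U,\mathcal{B})=\frac{K\wedge[F,F]_{\mathcal{B}}}{[K,F]_{\mathcal{B}}},$$ where $p\colon F\to U$ is any projective presentation of $U$ with kernel $K$. Here $[X,X]_{\mathcal{B}}$ is the kernel of $\eta_X\colon X\to I(X)$, which is functorial in $X$, and $[K,F]_{\mathcal{B}}$ is the kernel of $[p_0,p_0]_{\mathcal{B}}\colon[F\times_UF,F\times_UF]_{\mathcal{B}}\to[F,F]_{\mathcal{B}}$, regarded as a subobject of $[F,F]_{\mathcal{B}}$ via $[p_1,p_1]_{\mathcal{B}}$, where $p_0,p_1\colon F\times_UF\to F$ are the kernel pair projections of $p$. Then a $\mathcal{B}$-central extension $u\colon U\to A$ is universal if and only if $H_1(U,\mathcal{B})=0$ and $H_2(U,\mathcal{B})=0$. (The equivalence holds for every choice of the projective presentation $p$ of $U$ used to compute $H_2(U,\mathcal{B})$.)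 -/

import Mathlib

open CategoryTheory CategoryTheory.Limits

universe v u

namespace SemiAb

/-! ### Semi-abelian categories -/

/-- A semi-abelian category: pointed (zero object, and the resulting zero morphisms), Barr exact
(regular, and every internal equivalence relation is a kernel pair), Bourn protomodular
(for a pointed regular category: the regular Short Five Lemma), with binary coproducts. -/
class SemiAbelian (C : Type u) [Category.{v} C] [HasZeroMorphisms C] : Prop extends
    Regular C, HasZeroObject C, HasBinaryCoproducts C where
  /-- Barr exactness: equivalence relations are effective. -/
  effective : ∀ {R X : C} (p₁ p₂ : R ⟶ X), IsEquivalenceRelation p₁ p₂ →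
    ∃ (Y : C) (g : X ⟶ Y), IsKernelPair g p₁ p₂
  /-- The regular Short Five Lemma. -/
  short_five : ∀ {B' A' B A : C} (f' : B' ⟶ A') (f : B ⟶ A) (b : B' ⟶ B) (a : A' ⟶ A)
    (h : f' ≫ a = b ≫ f), IsRegularEpi f' → IsRegularEpi f →
    IsIso (kernel.map f' f b a h) → IsIso a → IsIso b

variable {C : Type u} [Category.{v} C]

/-! ### Projectivity relative to regular epimorphisms -/

/-- `X` is (regular) projective: it has the lifting property against all regular epimorphisms. -/
def IsRegularProjective (X : C) : Prop :=
  ∀ ⦃E Y : C⦄ (e : E ⟶ Y), IsRegularEpi e → ∀ f : X ⟶ Y, ∃ f' : X ⟶ E, f' ≫ e = f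

/-- `p : F ⟶ A` is a projective presentation of `A`: a regular epimorphism with projective
domain. -/
structure IsProjectivePresentation {F A : C} (p : F ⟶ A) : Prop where
  projective : IsRegularProjective F
  regularEpi : IsRegularEpi p

variable (C) in
/-- Every object has a projective presentation. -/
def HasEnoughRegularProjectives : Prop :=
  ∀ A : C, ∃ (F : C) (p : F ⟶ A), IsProjectivePresentation p

/-! ### Reflections and Birkhoff subcategories

A full replete subcategory of `C` is a predicate `P : ObjectProperty C` on its objects. -/

/-- `η : X ⟶ Y` exhibits `Y` as the reflection of `X` in the full subcategory `P`. -/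
structure IsReflection (P : ObjectProperty C) {X Y : C} (η : X ⟶ Y) : Prop where
  prop : P Y
  existsUnique : ∀ ⦃Z : C⦄, P Z → ∀ g : X ⟶ Z, ∃! h : Y ⟶ Z, η ≫ h = g

/-- A Birkhoff subcategory: full, reflective, closed under subobjects and regular quotients. -/
class IsBirkhoff (P : ObjectProperty C) : Prop extends P.IsClosedUnderSubobjects where
  reflective : P.ι.IsRightAdjoint
  prop_of_isRegularEpi : ∀ {X Y : C} (f : X ⟶ Y), IsRegularEpi f → P X → P Y

attribute [instance] IsBirkhoff.reflective

section Reflector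

variable (P : ObjectProperty C) [IsBirkhoff P]

/-- The reflector of a Birkhoff subcategory, as an endofunctor of the ambient category. -/
noncomputable def refl : C ⥤ C := P.ι.leftAdjoint ⋙ P.ι

/-- The unit of the reflection. -/
noncomputable def unit : 𝟭 C ⟶ refl P := (Adjunction.ofIsRightAdjoint P.ι).unit

theorem isReflection_unit (X : C) : IsReflection P ((unit P).app X) where
  prop := (P.ι.leftAdjoint.obj X).property
  existsUnique Z hZ g := by
    let adj := Adjunction.ofIsRightAdjoint P.ι
    let Z' : P.FullSubcategory := ⟨Z, hZ⟩
    refine ⟨P.ι.map ((adj.homEquiv X Z').symm g), ?_, ?_⟩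
    · exact (adj.homEquiv_unit X Z' _).symm.trans ((adj.homEquiv X Z').apply_symm_apply g)
    · intro h hh
      obtain ⟨h', rfl⟩ := P.ι.map_surjective (X := P.ι.leftAdjoint.obj X) (Y := Z') h
      congr 1
      apply (adj.homEquiv X Z').injective
      rw [Equiv.apply_symm_apply]
      exact (adj.homEquiv_unit X Z' h').trans hh

end Reflector

/-! ### Perfect objects, trivial, central and universal central extensions

An extension is a regular epimorphism. These notions are phrased with the universal property of
reflections, so that they apply to any reflective full subcategory. -/

/-- `X` is `P`-perfect: its reflection in `P` is zero. -/
def IsPerfect (P : ObjectProperty C) (X : C) : Prop :=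
  ∃ (Y : C) (η : X ⟶ Y), IsReflection P η ∧ IsZero Y

/-- `f` is a `P`-trivial extension: the naturality square of the reflection at `f` is a
pullback. -/
def IsTrivialExtension (P : ObjectProperty C) {B A : C} (f : B ⟶ A) : Prop :=
  IsRegularEpi f ∧ ∃ (B' A' : C) (ηB : B ⟶ B') (ηA : A ⟶ A') (f' : B' ⟶ A'),
    IsReflection P ηB ∧ IsReflection P ηA ∧ IsPullback f ηB ηA f'

/-- For a Birkhoff subcategory, triviality can be tested on the unit of the reflector. -/
theorem isTrivialExtension_iff (P : ObjectProperty C) [IsBirkhoff P] {B A : C} (f : B ⟶ A) :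
    IsTrivialExtension P f ↔ IsRegularEpi f ∧
      IsPullback f ((unit P).app B) ((unit P).app A) ((refl P).map f) := by
  refine and_congr_right fun _ => ⟨?_, fun h =>
    ⟨_, _, _, _, _, isReflection_unit P B, isReflection_unit P A, h⟩⟩
  rintro ⟨B', A', ηB, ηA, f', hB, hA, h⟩
  have key : ∀ {X Y Y' : C} {η : X ⟶ Y} {η' : X ⟶ Y'}, IsReflection P η → IsReflection P η' →
      ∃ e : Y ≅ Y', η ≫ e.hom = η' := by
    intro X Y Y' η η' h₁ h₂
    obtain ⟨a, ha, -⟩ := h₁.existsUnique h₂.prop η'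
    obtain ⟨b, hb, -⟩ := h₂.existsUnique h₁.prop η
    exact ⟨⟨a, b, (h₁.existsUnique h₁.prop η).unique (by rw [reassoc_of% ha, hb]) (by simp),
      (h₂.existsUnique h₂.prop η').unique (by rw [reassoc_of% hb, ha]) (by simp)⟩, ha⟩
  obtain ⟨eB, hB'⟩ := key hB (isReflection_unit P B)
  obtain ⟨eA, hA'⟩ := key hA (isReflection_unit P A)
  refine h.of_iso (Iso.refl _) (Iso.refl _) eB eA (by simp) (by simp [hB']) (by simp [hA']) ?_
  refine (hB.existsUnique (isReflection_unit P A).prop (f ≫ (unit P).app A)).unique ?_ ?_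
  · rw [← reassoc_of% h.w, hA']
  · rw [reassoc_of% hB']
    exact ((unit P).naturality f).symm

/-- `f` is a `P`-central extension: some pullback `g^*(f)` of `f` along an extension `g` is
`P`-trivial. -/
def IsCentralExtension [HasPullbacks C] (P : ObjectProperty C) {B A : C} (f : B ⟶ A) : Prop :=
  IsRegularEpi f ∧ ∃ (D : C) (g : D ⟶ A), IsRegularEpi g ∧
    IsTrivialExtension P (pullback.snd f g)

/-- `u` is a universal `P`-central extension of `A`: an initial object among the `P`-central
extensions of `A`. -/
def IsUniversalCentralExtension [HasPullbacks C] (P : ObjectProperty C) {U A : C} (u : U ⟶ A) :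
    Prop :=
  IsCentralExtension P u ∧ ∀ ⦃B : C⦄ (f : B ⟶ A), IsCentralExtension P f →
    ∃! g : U ⟶ B, g ≫ f = u

/-! ### Abelian objects and condition (UCE) -/

variable (C) in
/-- The objects that admit an internal abelian group structure (with respect to the categorical
product). -/
def abelianObjects [HasFiniteProducts C] : ObjectProperty C := fun X =>
  letI : CartesianMonoidalCategory C := CartesianMonoidalCategory.ofHasFiniteProducts
  letI : BraidedCategory C := BraidedCategory.ofCartesianMonoidalCategory
  ∃ _ : GrpObj X, IsCommMonObj X

variable (C) in
/-- Condition (UCE): `Ab(C)`-central extensions `f : B ⟶ A` and `g : D ⟶ B` have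
an `Ab(C)`-central composite as soon as `B` is `Ab(C)`-perfect. -/
def ConditionUCE [HasFiniteLimits C] : Prop :=
  ∀ ⦃D B A : C⦄ (g : D ⟶ B) (f : B ⟶ A), IsPerfect (abelianObjects C) B →
    IsCentralExtension (abelianObjects C) f → IsCentralExtension (abelianObjects C) g →
      IsCentralExtension (abelianObjects C) (g ≫ f)

/-! ### Commutators -/

section Commutator

variable [HasZeroMorphisms C] [HasFiniteLimits C] (P : ObjectProperty C) [IsBirkhoff P]

/-- The zero-dimensional commutator `[X,X]_P`: the kernel of the unit at `X`. -/
noncomputable abbrev comm₀ (X : C) : C := kernel ((unit P).app X)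

/-- The inclusion of `[X,X]_P` in `X`. -/
noncomputable abbrev μ (X : C) : comm₀ P X ⟶ X := kernel.ι ((unit P).app X)

/-- The functorial action `[f,f]_P` of the zero-dimensional commutator. -/
noncomputable def comm₀Map {X Y : C} (f : X ⟶ Y) : comm₀ P X ⟶ comm₀ P Y :=
  kernel.map _ _ f ((refl P).map f) ((unit P).naturality f).symm

@[simp]
theorem comm₀Map_μ {X Y : C} (f : X ⟶ Y) : comm₀Map P f ≫ μ P Y = μ P X ≫ f := by
  simp [comm₀Map]

@[simp]
theorem comm₀Map_μ_assoc {X Y Z : C} (f : X ⟶ Y) (h : Y ⟶ Z) :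
    comm₀Map P f ≫ μ P Y ≫ h = μ P X ≫ f ≫ h := by
  rw [← Category.assoc, comm₀Map_μ, Category.assoc]

/-- The one-dimensional commutator `[K,B]_P` of `f : B ⟶ A` with kernel `K`: the kernel of
`[f₀,f₀]_P`, where `f₀` and `f₁` are the kernel pair projections of `f`. -/
noncomputable abbrev comm₁ {B A : C} (f : B ⟶ A) : C :=
  kernel (comm₀Map P (pullback.fst f f))

/-- The canonical morphism from `[K,B]_P` to `[B,B]_P`, induced by `[f₁,f₁]_P`. -/
noncomputable def comm₁ι {B A : C} (f : B ⟶ A) : comm₁ P f ⟶ comm₀ P B :=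
  kernel.ι (comm₀Map P (pullback.fst f f)) ≫ comm₀Map P (pullback.snd f f)

theorem comm₁ι_condition {B A : C} (f : B ⟶ A) : (comm₁ι P f ≫ μ P B) ≫ f = 0 := by
  simp only [comm₁ι, Category.assoc, comm₀Map_μ]
  rw [← pullback.condition, ← comm₀Map_μ_assoc, kernel.condition_assoc, zero_comp]

/-- The intersection of the kernel `K` of `f : B ⟶ A` with `[B,B]_P`, as subobjects of `B`. -/
noncomputable abbrev kerMeet {B A : C} (f : B ⟶ A) : C := pullback (kernel.ι f) (μ P B)

/-- The inclusion of `[K,B]_P` in the intersection of `K` with `[B,B]_P`. -/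
noncomputable def comm₁ToKerMeet {B A : C} (f : B ⟶ A) : comm₁ P f ⟶ kerMeet P f :=
  pullback.lift (kernel.lift f (comm₁ι P f ≫ μ P B) (comm₁ι_condition P f)) (comm₁ι P f)
    (by simp)

end Commutator

/-! ### Existence of the quotient in the Hopf formula -/

section Quotient

variable [HasZeroMorphisms C] [SemiAbelian C]

/-- A section of `p` and the kernel of `p` do not factor through a common proper subobject. -/
theorem isIso_of_section_of_kernel {X Y M : C} (p : X ⟶ Y) (s : Y ⟶ X) (hs : s ≫ p = 𝟙 Y)
    (m : M ⟶ X) [Mono m] (s' : Y ⟶ M) (hs' : s' ≫ m = s) (k : kernel p ⟶ M)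
    (hk : k ≫ m = kernel.ι p) : IsIso m := by
  have h₁ : IsSplitEpi p := ⟨⟨⟨s, hs⟩⟩⟩
  have h₂ : IsSplitEpi (m ≫ p) := ⟨⟨⟨s', by rw [reassoc_of% hs', hs]⟩⟩⟩
  refine SemiAbelian.short_five (m ≫ p) p m (𝟙 Y) (by simp) inferInstance inferInstance ?_
    inferInstance
  refine ⟨kernel.lift (m ≫ p) k (by rw [reassoc_of% hk, kernel.condition]), ?_, ?_⟩
  · rw [← cancel_mono (kernel.ι (m ≫ p)), ← cancel_mono m]
    simp [hk]
  · rw [← cancel_mono (kernel.ι p)]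
    simp [hk]

/-- Reflexive relations are transitive. -/
theorem transitive_of_reflexive {R X : C} (p₁ p₂ : R ⟶ X) [JointlyMono₂ p₁ p₂] (r : X ⟶ R)
    (h₁ : r ≫ p₁ = 𝟙 X) (h₂ : r ≫ p₂ = 𝟙 X) :
    ∃ t : pullback p₂ p₁ ⟶ R, t ≫ p₁ = pullback.fst p₂ p₁ ≫ p₁ ∧
      t ≫ p₂ = pullback.snd p₂ p₁ ≫ p₂ := by
  let j : R ⟶ X ⨯ X := prod.lift p₁ p₂
  have hj : Mono j := ⟨fun a b h => JointlyMono₂.right_cancellation (p₁ := p₁) (p₂ := p₂) a b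
    (by simpa [j, prod.lift_fst] using h =≫ prod.fst)
    (by simpa [j, prod.lift_snd] using h =≫ prod.snd)⟩
  let w : pullback p₂ p₁ ⟶ X ⨯ X :=
    prod.lift (pullback.fst p₂ p₁ ≫ p₁) (pullback.snd p₂ p₁ ≫ p₂)
  let s : R ⟶ pullback p₂ p₁ := pullback.lift (𝟙 R) (p₂ ≫ r) (by simp [h₁])
  let q := pullback.fst p₂ p₁
  have hk : (kernel.ι q ≫ pullback.snd p₂ p₁) ≫ p₁ = 0 := by
    rw [Category.assoc, ← pullback.condition, kernel.condition_assoc, zero_comp]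
  have : IsIso (pullback.fst w j) := by
    refine isIso_of_section_of_kernel q s (by simp [s, q, pullback.lift_fst]) (pullback.fst w j)
      (pullback.lift s (𝟙 R) ?_) (pullback.lift_fst _ _ _)
      (pullback.lift (kernel.ι q) (kernel.ι q ≫ pullback.snd p₂ p₁) ?_)
      (pullback.lift_fst _ _ _)
    · ext <;> simp [s, w, j, h₂, pullback.lift_fst_assoc, pullback.lift_snd_assoc, prod.lift_fst,
        prod.lift_snd]
    · ext
      · simp only [w, j, Category.assoc, prod.lift_fst]
        rw [← Category.assoc _ _ p₁, kernel.condition, zero_comp]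
        simpa using hk.symm
      · simp [w, j, prod.lift_snd]
  refine ⟨inv (pullback.fst w j) ≫ pullback.snd w j, ?_, ?_⟩
  · have := pullback.condition (f := w) (g := j) =≫ prod.fst
    simp only [w, j, Category.assoc, prod.lift_fst] at this
    simp [w, j, ← this]
  · have := pullback.condition (f := w) (g := j) =≫ prod.snd
    simp only [w, j, Category.assoc, prod.lift_snd] at this
    simp [w, j, ← this]

/-- Kernels have cokernels. -/
theorem hasCokernel_of_isKernel {N X Z : C} (n : N ⟶ X) (g : X ⟶ Z) (hn : n ≫ g = 0)
    (hl : ∀ ⦃T : C⦄ (t : T ⟶ X), t ≫ g = 0 → ∃ l : T ⟶ N, l ≫ n = t) : HasCokernel n := by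
  let a := pullback.fst g g
  let b := pullback.snd g g
  have : HasCoequalizer a b :=
    Regular.hasCoequalizer_of_isKernelPair (IsKernelPair.of_hasPullback g)
  have hn' : n ≫ coequalizer.π a b = 0 := by
    have : pullback.lift (f := g) (g := g) 0 n (by simp [hn]) ≫ b = n := by simp [b, pullback.lift_snd]
    rw [← this, Category.assoc, ← coequalizer.condition, ← Category.assoc]
    simp [a, pullback.lift_fst_assoc]
  have key : ∀ {W : C} (h : X ⟶ W), n ≫ h = 0 → a ≫ h = b ≫ h := by
    intro W h hh
    let d : X ⟶ pullback g g := pullback.lift (𝟙 X) (𝟙 X) rfl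
    have hka : kernel.ι a ≫ a ≫ h = kernel.ι a ≫ b ≫ h := by
      obtain ⟨l, hl⟩ := hl (kernel.ι a ≫ b) (by
        rw [Category.assoc, ← pullback.condition, kernel.condition_assoc, zero_comp])
      rw [kernel.condition_assoc, zero_comp, ← Category.assoc, ← hl, Category.assoc, hh,
        comp_zero]
    have : IsIso (equalizer.ι (a ≫ h) (b ≫ h)) :=
      isIso_of_section_of_kernel a d (by simp [a, d, pullback.lift_fst]) _
        (equalizer.lift d (by simp [a, b, d, pullback.lift_fst_assoc, pullback.lift_snd_assoc]))
        (by simp) (equalizer.lift (kernel.ι a) hka) (by simp)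
    rw [← cancel_epi (equalizer.ι (a ≫ h) (b ≫ h))]
    exact equalizer.condition _ _
  exact ⟨⟨⟨_, CokernelCofork.IsColimit.ofπ (coequalizer.π a b) hn'
    (fun h hh => coequalizer.desc h (key h hh)) (fun h hh => by simp)
    (fun h hh m hm => by
      apply coequalizer.hom_ext
      simpa using hm)⟩⟩⟩

variable (P : ObjectProperty C) [IsBirkhoff P]

theorem comm₀Map_comp {X Y Z : C} (f : X ⟶ Y) (g : Y ⟶ Z) :
    comm₀Map P (f ≫ g) = comm₀Map P f ≫ comm₀Map P g := by
  rw [← cancel_mono (μ P Z)]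
  simp

theorem comm₀Map_id (X : C) : comm₀Map P (𝟙 X) = 𝟙 _ := by
  rw [← cancel_mono (μ P X)]
  simp

/-- `[f₀,f₀]_P` and `[f₁,f₁]_P` form an equivalence relation on `[B,B]_P`. -/
theorem isEquivalenceRelation_comm₀Map {B A : C} (f : B ⟶ A) :
    IsEquivalenceRelation (comm₀Map P (pullback.fst f f)) (comm₀Map P (pullback.snd f f)) := by
  have jm : JointlyMono₂ (comm₀Map P (pullback.fst f f)) (comm₀Map P (pullback.snd f f)) :=
    ⟨fun Y a b h₁ h₂ => by
      rw [← cancel_mono (μ P _)]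
      apply pullback.hom_ext
      · simpa using h₁ =≫ μ P B
      · simpa using h₂ =≫ μ P B⟩
  let d : B ⟶ pullback f f := pullback.lift (𝟙 B) (𝟙 B) rfl
  let σ : pullback f f ⟶ pullback f f :=
    pullback.lift (pullback.snd f f) (pullback.fst f f) pullback.condition.symm
  have hd₁ : comm₀Map P d ≫ comm₀Map P (pullback.fst f f) = 𝟙 _ := by
    rw [← comm₀Map_comp, ← comm₀Map_id]; simp [d, pullback.lift_fst]
  have hd₂ : comm₀Map P d ≫ comm₀Map P (pullback.snd f f) = 𝟙 _ := by
    rw [← comm₀Map_comp, ← comm₀Map_id]; simp [d, pullback.lift_snd]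
  obtain ⟨t, ht₁, ht₂⟩ := transitive_of_reflexive _ _ (comm₀Map P d) hd₁ hd₂
  exact ⟨⟨{ jm with
    r := comm₀Map P d
    reflexivity₁ := hd₁
    reflexivity₂ := hd₂
    s := comm₀Map P σ
    symmetry₁ := by rw [← comm₀Map_comp]; simp [σ, pullback.lift_fst]
    symmetry₂ := by rw [← comm₀Map_comp]; simp [σ, pullback.lift_snd]
    c := pullback.cone _ _
    isLimit := pullback.isLimit _ _
    t := t
    transitivity₁ := ht₁
    transitivity₂ := ht₂ }⟩⟩

/-- `[K,B]_P` is normal in the intersection of `K` with `[B,B]_P`, so that the quotient exists. -/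
instance hasCokernel_comm₁ToKerMeet {B A : C} (f : B ⟶ A) : HasCokernel (comm₁ToKerMeet P f) := by
  obtain ⟨Z, g, hg⟩ := SemiAbelian.effective _ _ (isEquivalenceRelation_comm₀Map P f)
  have hc : comm₁ToKerMeet P f ≫ pullback.snd (kernel.ι f) (μ P B) = comm₁ι P f := by
    simp [comm₁ToKerMeet, pullback.lift_snd]
  refine hasCokernel_of_isKernel _ (pullback.snd (kernel.ι f) (μ P B) ≫ g) ?_ ?_
  · rw [reassoc_of% hc, comm₁ι, Category.assoc, ← hg.w, kernel.condition_assoc, zero_comp]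
  · intro T t ht
    have h₀ : (0 : T ⟶ comm₀ P B) ≫ g = (t ≫ pullback.snd (kernel.ι f) (μ P B)) ≫ g := by
      rw [zero_comp, Category.assoc, ht]
    refine ⟨kernel.lift _ (hg.lift _ _ h₀) (hg.lift_fst _ _ _), ?_⟩
    rw [← cancel_mono (pullback.snd (kernel.ι f) (μ P B)), Category.assoc, hc, comm₁ι,
      kernel.lift_ι_assoc, hg.lift_snd]

end Quotient

/-! ### Homology objects -/

section Homology

variable [HasZeroMorphisms C] [SemiAbelian C] (P : ObjectProperty C) [IsBirkhoff P]

/-- The first homology object `H₁(X,P)`: the reflection of `X` in the Birkhoff subcategory. -/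
noncomputable def H₁ (X : C) : C := (refl P).obj X

/-- The Hopf formula `(K ∧ [B,B]_P) / [K,B]_P` of `f : B ⟶ A` with kernel `K`. When `f` is a
projective presentation, this is the second homology object `H₂(A,P)`, computed from `f`. -/
noncomputable def H₂ {B A : C} (f : B ⟶ A) : C := cokernel (comm₁ToKerMeet P f)

end Homology

end SemiAb

/-! Everything is read off the functor X ↦ [X,X]. It preserves regular epimorphisms
(`isRegularEpi_comm₀Map`). A regular epimorphism is trivial exactly when the functor sends it to a
monomorphism, and central exactly when the functor does so to a projection of its kernel pair
(`isCentralExtension_iff`). If U is perfect then [U,U] = U, so maps from U into a central extension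
are determined by their composite to the base (`eq_of_isPerfect`).

Suppose H₁ and H₂ vanish. A lift of p along a central extension V → U kills [K,F] on commutators,
hence kills K ∧ [F,F], the kernel of [F,F] → [U,U] = U. It therefore descends to a section of V → U
(`exists_section_of_isZero_H₂`). For V the pullback along u of a central extension of A, this
section gives the universal map.

Conversely, universality tested on A × I(U) → A makes U perfect. Let E = F/[K,F], a central
extension of U (`exists_centralization`). Then W = [E,E] is perfect and central over U. For perfect
domains, centrality with respect to P and to Ab(C) agree, so (UCE) makes W → U → A central.
Universality yields a section of W → U, and perfectness of W makes it an inverse. So K ∧ [F,F] → W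
is zero, that is, K ∧ [F,F] lies in [K,F]. -/

namespace SemiAb

/-! ### Regular epimorphisms in a regular category -/

/-- Factoring through a monomorphism can be tested on a cover. -/
theorem exists_lift_of_cover {C : Type u} [Category.{v} C] {T' T X M : C} (c : T' ⟶ T) (hc : IsRegularEpi c) (t : T ⟶ X)
    (m : M ⟶ X) [Mono m] (s : T' ⟶ M) (h : s ≫ m = c ≫ t) : ∃ l : T ⟶ M, l ≫ m = t :=
  have sq : CommSq s c m t := ⟨h⟩
  ⟨sq.lift, sq.fac_right⟩

section Regular

variable {C : Type u} [Category.{v} C] [Regular C]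

theorem isRegularEpi_comp {X Y Z : C} (f : X ⟶ Y) (g : Y ⟶ Z) (hf : IsRegularEpi f)
    (hg : IsRegularEpi g) : IsRegularEpi (f ≫ g) := by
  have : StrongEpi (f ≫ g) := strongEpi_comp f g
  infer_instance

theorem isRegularEpi_of_comp {X Y Z : C} (f : X ⟶ Y) (g : Y ⟶ Z) (h : IsRegularEpi (f ≫ g)) :
    IsRegularEpi g := by
  have : StrongEpi g := strongEpi_of_strongEpi f g
  infer_instance

theorem isRegularEpi_of_isPullback {X Y Z W : C} {a : X ⟶ Y} {b : X ⟶ Z} {f : Y ⟶ W} {g : Z ⟶ W}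
    (h : IsPullback a b f g) (hf : IsRegularEpi f) : IsRegularEpi b :=
  Regular.regularEpiIsStableUnderBaseChange.of_isPullback h hf

/-- Regular epimorphisms allow lifting along a cover. -/
theorem exists_cover_lift {X Y T : C} (f : X ⟶ Y) (hf : IsRegularEpi f) (t : T ⟶ Y) :
    ∃ (T' : C) (c : T' ⟶ T) (s : T' ⟶ X), IsRegularEpi c ∧ s ≫ f = c ≫ t :=
  ⟨_, pullback.snd f t, pullback.fst f t, inferInstance, pullback.condition⟩

theorem exists_isRegularEpi_mono_fac {X Y : C} (f : X ⟶ Y) :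
    ∃ (I : C) (e : X ⟶ I) (m : I ⟶ Y), IsRegularEpi e ∧ Mono m ∧ e ≫ m = f :=
  let F := Regular.strongEpiMonoFactorisation f
  ⟨F.I, F.e, F.m, inferInstance, inferInstance, F.fac⟩

/-- The two coordinates of a pair are lifted along `q` one after the other, each on a cover. -/
theorem isRegularEpi_kernelPair_map {F E U : C} (q : F ⟶ E) (e : E ⟶ U) (p : F ⟶ U)
    (hp : q ≫ e = p) (hq : IsRegularEpi q) :
    IsRegularEpi (pullback.map p p e e q q (𝟙 U) (by simp [hp]) (by simp [hp])) := by
  obtain ⟨T₁, c₁, s₁, hc₁, h₁⟩ := exists_cover_lift q hq (pullback.fst e e)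
  obtain ⟨T₂, c₂, s₂, hc₂, h₂⟩ := exists_cover_lift q hq (c₁ ≫ pullback.snd e e)
  have h : (c₂ ≫ s₁) ≫ p = s₂ ≫ p := by
    rw [← hp, reassoc_of% h₂, Category.assoc, reassoc_of% h₁, pullback.condition]
  refine isRegularEpi_of_comp (pullback.lift _ _ h) _ ?_
  have : pullback.lift _ _ h ≫ pullback.map p p e e q q (𝟙 U) (by simp [hp]) (by simp [hp]) =
      c₂ ≫ c₁ := by
    apply pullback.hom_ext
    · simp [pullback.lift_fst_assoc, pullback.lift_fst, h₁]
    · simp [pullback.lift_snd_assoc, pullback.lift_snd, h₂]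
  rw [this]
  exact isRegularEpi_comp _ _ hc₂ hc₁

end Regular

/-! ### Consequences of protomodularity -/

section Protomodular

variable {C : Type u} [Category.{v} C] [HasZeroMorphisms C] [SemiAbelian C]

/-- The equalizer of the two maps contains both the section and the kernel, so it is everything. -/
theorem eq_of_section_of_kernel {X Y A : C} (p : X ⟶ Y) (s : Y ⟶ X) (hs : s ≫ p = 𝟙 Y)
    (φ ψ : X ⟶ A) (h₁ : s ≫ φ = s ≫ ψ) (h₂ : kernel.ι p ≫ φ = kernel.ι p ≫ ψ) : φ = ψ := by
  have : IsIso (equalizer.ι φ ψ) :=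
    isIso_of_section_of_kernel p s hs _ (equalizer.lift s h₁) (by simp)
      (equalizer.lift (kernel.ι p) h₂) (by simp)
  rw [← cancel_epi (equalizer.ι φ ψ)]
  exact equalizer.condition _ _

theorem exists_lift_of_section_of_kernel {X Y A M : C} (p : X ⟶ Y) (s : Y ⟶ X)
    (hs : s ≫ p = 𝟙 Y) (φ : X ⟶ A) (m : M ⟶ A) [Mono m] (s' : Y ⟶ M) (hs' : s' ≫ m = s ≫ φ)
    (k : kernel p ⟶ M) (hk : k ≫ m = kernel.ι p ≫ φ) : ∃ l : X ⟶ M, l ≫ m = φ := by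
  have : IsIso (pullback.fst φ m) :=
    isIso_of_section_of_kernel p s hs _ (pullback.lift s s' hs'.symm) (pullback.lift_fst _ _ _)
      (pullback.lift (kernel.ι p) k hk.symm) (pullback.lift_fst _ _ _)
  exact ⟨inv (pullback.fst φ m) ≫ pullback.snd φ m, by
    rw [Category.assoc, ← pullback.condition, IsIso.inv_hom_id_assoc]⟩

theorem mono_of_forall_eq_zero {X Y : C} (f : X ⟶ Y)
    (h : ∀ ⦃T : C⦄ (t : T ⟶ X), t ≫ f = 0 → t = 0) : Mono f := by
  have key : pullback.fst f f = pullback.snd f f := by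
    refine eq_of_section_of_kernel (pullback.fst f f) (pullback.diagonal f) (by simp) _ _
      (by simp) ?_
    rw [kernel.condition, h (kernel.ι (pullback.fst f f) ≫ pullback.snd f f)]
    rw [Category.assoc, ← pullback.condition, kernel.condition_assoc, zero_comp]
  exact (IsKernelPair.of_hasPullback f).mono_of_eq_fst_snd key

/-- A regular epimorphism is the cokernel of its kernel. -/
theorem exists_desc_of_kernel {X Y Z : C} (f : X ⟶ Y) (hf : IsRegularEpi f) (h : X ⟶ Z)
    (hk : kernel.ι f ≫ h = 0) : ∃ l : Y ⟶ Z, f ≫ l = h := by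
  have key : pullback.fst f f ≫ h = pullback.snd f f ≫ h := by
    refine eq_of_section_of_kernel (pullback.fst f f) (pullback.diagonal f) (by simp) _ _
      (by simp) ?_
    obtain ⟨l, hl⟩ : ∃ l, l ≫ kernel.ι f = kernel.ι (pullback.fst f f) ≫ pullback.snd f f :=
      ⟨kernel.lift f _ (by
        rw [Category.assoc, ← pullback.condition, kernel.condition_assoc, zero_comp]),
        kernel.lift_ι _ _ _⟩
    rw [kernel.condition_assoc, zero_comp, ← Category.assoc, ← hl, Category.assoc, hk, comp_zero]
  exact ⟨((IsKernelPair.of_hasPullback f).toCoequalizer').desc (Cofork.ofπ h key),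
    ((IsKernelPair.of_hasPullback f).toCoequalizer').fac (Cofork.ofπ h key) .one⟩

/-- Direct images of normal subobjects along regular epimorphisms are normal. -/
theorem exists_quotient_of_image {B A Z : C} (f : B ⟶ A) (hf : IsRegularEpi f) (h : B ⟶ Z) :
    ∃ (Q : C) (q : A ⟶ Q), IsRegularEpi q ∧
      (∀ ⦃T : C⦄ (x y : T ⟶ B), x ≫ h = y ≫ h → x ≫ f ≫ q = y ≫ f ≫ q) ∧
      ∀ ⦃T : C⦄ (t : T ⟶ A), t ≫ q = 0 → ∃ (T' : C) (c : T' ⟶ T) (s : T' ⟶ kernel h),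
        IsRegularEpi c ∧ s ≫ kernel.ι h ≫ f = c ≫ t := by
  -- The image `S` in `A ⨯ A` of the kernel pair of `h` is reflexive because `f` is a cover, and it
  -- inherits symmetry; transitivity is then automatic.
  let r : pullback h h ⟶ A ⨯ A := prod.lift (pullback.fst h h ≫ f) (pullback.snd h h ≫ f)
  obtain ⟨S, e, m, he, hm, hem⟩ := exists_isRegularEpi_mono_fac r
  have e₁ : e ≫ m ≫ prod.fst = pullback.fst h h ≫ f := by
    rw [reassoc_of% hem, prod.lift_fst]
  have e₂ : e ≫ m ≫ prod.snd = pullback.snd h h ≫ f := by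
    rw [reassoc_of% hem, prod.lift_snd]
  have jm : JointlyMono₂ (m ≫ prod.fst) (m ≫ prod.snd) := ⟨fun Y a b h₁ h₂ => by
    rw [← cancel_mono m]
    ext
    · simpa using h₁
    · simpa using h₂⟩
  obtain ⟨d, hd⟩ : ∃ d : A ⟶ S, d ≫ m = prod.lift (𝟙 A) (𝟙 A) := by
    refine exists_lift_of_cover f hf _ m (pullback.diagonal h ≫ e) ?_
    rw [Category.assoc, hem]
    ext <;> simp [r, prod.lift_fst, prod.lift_snd]
  obtain ⟨σ, hσ⟩ : ∃ σ : S ⟶ S, σ ≫ m = m ≫ prod.lift prod.snd prod.fst := by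
    refine exists_lift_of_cover e he _ m
      (pullback.lift (pullback.snd h h) (pullback.fst h h) pullback.condition.symm ≫ e) ?_
    rw [Category.assoc, hem, reassoc_of% hem]
    ext <;> simp [r, prod.lift_fst, prod.lift_snd, pullback.lift_fst_assoc,
      pullback.lift_snd_assoc]
  have hd₁ : d ≫ m ≫ prod.fst = 𝟙 A := by rw [reassoc_of% hd, prod.lift_fst]
  have hd₂ : d ≫ m ≫ prod.snd = 𝟙 A := by rw [reassoc_of% hd, prod.lift_snd]
  obtain ⟨t, ht₁, ht₂⟩ := transitive_of_reflexive _ _ d hd₁ hd₂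
  have heq : IsEquivalenceRelation (m ≫ prod.fst) (m ≫ prod.snd) := ⟨⟨{ jm with
    r := d
    reflexivity₁ := hd₁
    reflexivity₂ := hd₂
    s := σ
    symmetry₁ := by rw [reassoc_of% hσ, prod.lift_fst]
    symmetry₂ := by rw [reassoc_of% hσ, prod.lift_snd]
    c := pullback.cone _ _
    isLimit := pullback.isLimit _ _
    t := t
    transitivity₁ := ht₁
    transitivity₂ := ht₂ }⟩⟩
  obtain ⟨Y, g, hg⟩ := SemiAbelian.effective _ _ heq
  -- Exactness does not provide a regular epimorphism `g`; its image part `q` has the same kernel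
  -- pair.
  obtain ⟨Q, q, i, hq, hi, hqi⟩ := exists_isRegularEpi_mono_fac g
  refine ⟨Q, q, hq, fun T x y hxy => ?_, fun T t ht => ?_⟩
  · rw [← cancel_mono i]
    have := (pullback.lift x y hxy ≫ e) ≫= hg.w
    simp only [Category.assoc] at this e₁ e₂
    rw [reassoc_of% e₁, reassoc_of% e₂, pullback.lift_fst_assoc, pullback.lift_snd_assoc] at this
    simpa [hqi] using this
  · have ht0 : t ≫ g = (0 : T ⟶ A) ≫ g := by rw [← hqi, reassoc_of% ht, zero_comp, zero_comp]
    obtain ⟨T₁, c₁, ρ, hc₁, hρ⟩ := exists_cover_lift e he (hg.lift _ _ ht0)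
    have ρ₁ : ρ ≫ pullback.fst h h ≫ f = c₁ ≫ t := by
      rw [← e₁, reassoc_of% hρ, hg.lift_fst]
    have ρ₂ : (ρ ≫ pullback.snd h h) ≫ f = 0 := by
      rw [Category.assoc, ← e₂, reassoc_of% hρ, hg.lift_snd, comp_zero]
    -- `M` is the image of `kernel h` in `A`, and `X` consists of the pairs (x, y) with h x = h y
    -- and f y = 0. To see that f x lies in `M`, split `p` by the diagonal: diagonal pairs have f x
    -- = 0, and pairs (x, 0) have x in `kernel h`.
    obtain ⟨M, e', m', he', hm', hem'⟩ := exists_isRegularEpi_mono_fac (kernel.ι h ≫ f)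
    let κ := kernel.ι f
    let X := pullback (pullback.snd h h) κ
    let p : X ⟶ kernel f := pullback.snd _ _
    let s : kernel f ⟶ X := pullback.lift (κ ≫ pullback.diagonal h) (𝟙 _) (by simp)
    have hp : (kernel.ι p ≫ pullback.fst _ _ ≫ pullback.fst h h) ≫ h = 0 := by
      simp only [Category.assoc]
      rw [pullback.condition, pullback.condition_assoc, kernel.condition_assoc, zero_comp]
    obtain ⟨l, hl⟩ := exists_lift_of_section_of_kernel p s (pullback.lift_snd _ _ _)
      (pullback.fst _ _ ≫ pullback.fst h h ≫ f) m' 0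
      (by simp [s, κ, pullback.lift_fst_assoc]) (kernel.lift h _ hp ≫ e') (by simp [hem'])
    let x : T₁ ⟶ X := pullback.lift ρ (kernel.lift f _ ρ₂) (by simp [κ])
    obtain ⟨T₂, c₂, y, hc₂, hy⟩ := exists_cover_lift e' he' (x ≫ l)
    refine ⟨T₂, c₂ ≫ c₁, y, isRegularEpi_comp _ _ hc₂ hc₁, ?_⟩
    rw [← hem', reassoc_of% hy, hl, pullback.lift_fst_assoc, ρ₁, Category.assoc]

end Protomodular

/-! ### Commutators and extensions -/

section Extensions

variable {C : Type u} [Category.{v} C] [HasZeroMorphisms C] [SemiAbelian C]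
  (P : ObjectProperty C) [IsBirkhoff P]

/-- Morphisms to objects of `P` vanish on the commutator. -/
theorem μ_comp_eq_zero {X Z : C} (hZ : P Z) (g : X ⟶ Z) : μ P X ≫ g = 0 := by
  obtain ⟨h, hh, -⟩ := (isReflection_unit P X).existsUnique hZ g
  rw [← hh, kernel.condition_assoc, zero_comp]

theorem isRegularEpi_unit (X : C) : IsRegularEpi ((unit P).app X) := by
  obtain ⟨I, e, m, he, hm, hem⟩ := exists_isRegularEpi_mono_fac ((unit P).app X)
  have hI : P I := P.prop_of_mono m (isReflection_unit P X).prop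
  obtain ⟨l, hl, -⟩ := (isReflection_unit P X).existsUnique hI e
  have : l ≫ m = 𝟙 _ := ((isReflection_unit P X).existsUnique
    (isReflection_unit P X).prop ((unit P).app X)).unique (by rw [reassoc_of% hl, hem]) (by simp)
  have : IsSplitEpi m := ⟨⟨⟨l, this⟩⟩⟩
  rw [← hem]
  exact isRegularEpi_comp _ _ he inferInstance

/-- The commutator functor preserves regular epimorphisms. -/
theorem isRegularEpi_comm₀Map {B A : C} (f : B ⟶ A) (hf : IsRegularEpi f) :
    IsRegularEpi (comm₀Map P f) := by
  -- `Q` is `A` modulo the image of [B,B]. It is a quotient of the reflection of `B`, hence in `P`,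
  -- so [A,A] dies in `Q` and is covered by [B,B].
  obtain ⟨Q, q, hq, h₁, h₂⟩ := exists_quotient_of_image f hf ((unit P).app B)
  have hQ : P Q := by
    obtain ⟨z, hz⟩ := exists_desc_of_kernel ((unit P).app B) (isRegularEpi_unit P B) (f ≫ q) (by
      simpa using h₁ (kernel.ι ((unit P).app B)) 0 (by simp))
    refine IsBirkhoff.prop_of_isRegularEpi z ?_ (isReflection_unit P B).prop
    exact isRegularEpi_of_comp _ _ (hz ▸ isRegularEpi_comp _ _ hf hq)
  obtain ⟨T, c, s, hc, hs⟩ := h₂ (μ P A) (μ_comp_eq_zero P hQ q)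
  refine isRegularEpi_of_comp s _ ?_
  have : s ≫ comm₀Map P f = c := by
    rw [← cancel_mono (μ P A), Category.assoc, comm₀Map_μ, hs]
  rwa [this]

/-- Maps into `P` vanish on [B,B], so there `f` alone must separate elements. -/
theorem mono_comm₀Map_of_jointly {B A Z : C} (f : B ⟶ A) (g : B ⟶ Z) (hZ : P Z)
    (h : ∀ ⦃T : C⦄ (x y : T ⟶ B), x ≫ f = y ≫ f → x ≫ g = y ≫ g → x = y) :
    Mono (comm₀Map P f) := by
  refine ⟨fun x y hxy => ?_⟩
  rw [← cancel_mono (μ P B)]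
  refine h _ _ ?_ ?_
  · simpa using hxy =≫ μ P A
  · simp only [Category.assoc, μ_comp_eq_zero P hZ, comp_zero]

/-- Trivial extensions are those that induce a monomorphism between the commutators. -/
theorem isTrivialExtension_of_mono {B A : C} (f : B ⟶ A) (hf : IsRegularEpi f)
    (h : Mono (comm₀Map P f)) : IsTrivialExtension P f := by
  rw [isTrivialExtension_iff]
  refine ⟨hf, ?_⟩
  have := isRegularEpi_comm₀Map P f hf
  have hiso : IsIso (comm₀Map P f) := isIso_of_mono_of_strongEpi _
  have := isRegularEpi_unit P A
  have := isRegularEpi_unit P B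
  let w := ((unit P).naturality f).symm
  -- Both source and target of `b` lie over the reflection of `B`, with kernels [B,B] and [A,A]; on
  -- kernels `b` is the isomorphism [f,f].
  let b : B ⟶ pullback ((unit P).app A) ((refl P).map f) := pullback.lift f ((unit P).app B) w.symm
  have hb : IsIso b := by
    refine SemiAbelian.short_five ((unit P).app B)
      (pullback.snd ((unit P).app A) ((refl P).map f)) b (𝟙 _) (by simp [b, pullback.lift_snd])
      inferInstance inferInstance ?_ inferInstance
    refine ⟨kernel.lift _ (kernel.ι _ ≫ pullback.fst _ _) ?_ ≫ inv (comm₀Map P f), ?_, ?_⟩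
    · rw [Category.assoc, pullback.condition, kernel.condition_assoc, zero_comp]
    · rw [← Category.assoc, IsIso.comp_inv_eq, Category.id_comp, ← cancel_mono (μ P A)]
      simp [b, pullback.lift_fst]
    · have key : inv (comm₀Map P f) ≫ μ P B ≫ f = μ P A := by simp [← comm₀Map_μ]
      rw [← cancel_mono (kernel.ι _)]
      apply pullback.hom_ext
      · simp [b, pullback.lift_fst, key]
      · simp [b, pullback.lift_snd, kernel.condition]
  refine IsPullback.of_iso (IsPullback.of_hasPullback ((unit P).app A) ((refl P).map f)).flip.flip
    (asIso b).symm (Iso.refl _) (Iso.refl _) (Iso.refl _) ?_ ?_ ?_ ?_ <;>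
    simp [b, pullback.lift_fst, pullback.lift_snd]

theorem mono_comm₀Map_of_isTrivialExtension {B A : C} (f : B ⟶ A) (h : IsTrivialExtension P f) :
    Mono (comm₀Map P f) :=
  mono_comm₀Map_of_jointly P f _ (isReflection_unit P B).prop fun _ _ _ h₁ h₂ =>
    ((isTrivialExtension_iff P f).1 h).2.hom_ext h₁ h₂

theorem mono_comm₀Map_of_isPullback {B A D E : C} {a : E ⟶ B} {g : E ⟶ D} {f : B ⟶ A}
    {h : D ⟶ A} (sq : IsPullback a g f h) (hf : Mono (comm₀Map P f)) : Mono (comm₀Map P g) := by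
  refine ⟨fun x y hxy => ?_⟩
  have hg : x ≫ μ P E ≫ g = y ≫ μ P E ≫ g := by simpa using hxy =≫ μ P D
  rw [← cancel_mono (μ P E)]
  refine sq.hom_ext ?_ (by simpa using hg)
  have : x ≫ comm₀Map P a = y ≫ comm₀Map P a := by
    rw [← cancel_mono (comm₀Map P f), ← cancel_mono (μ P A)]
    simpa [sq.w] using hg =≫ h
  simpa using this =≫ μ P B

/-! ### Centrality tested on the kernel pair -/

/-- A split pullback of a central extension is trivial. -/
theorem isIso_comm₀Map_of_isPullback_of_section {B A X V : C} {a : V ⟶ B} {g : V ⟶ X} {f : B ⟶ A}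
    {h : X ⟶ A} (sq : IsPullback a g f h) (hf : IsCentralExtension P f) (s : X ⟶ V)
    (hs : s ≫ g = 𝟙 X) : IsIso (comm₀Map P s) ∧ IsIso (comm₀Map P g) := by
  obtain ⟨-, D, d, hd, htriv⟩ := hf
  let D' := pullback d h
  let c : D' ⟶ X := pullback.snd d h
  -- `E ⟶ D'` is also a pullback of the trivial extension over `D`, so it is mono on commutators;
  -- its section `t` makes it an isomorphism there. Since `E ⟶ V` is a cover, `s` becomes a strong
  -- epimorphism on commutators as well as a split monomorphism.
  let E := pullback g c
  have sq₁ : IsPullback (pullback.fst g c ≫ a) (pullback.snd g c) f (pullback.fst d h ≫ d) := by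
    rw [pullback.condition]
    exact (IsPullback.of_hasPullback g c).paste_horiz sq
  have sq₂ := IsPullback.of_right
    (h₁₁ := pullback.lift (pullback.fst g c ≫ a) (pullback.snd g c ≫ pullback.fst d h)
      (by simpa using sq₁.w))
    (v₁₁ := pullback.snd g c) (h₂₁ := pullback.fst d h)
    (by simpa [pullback.lift_fst] using sq₁) (by simp [pullback.lift_snd])
    (IsPullback.of_hasPullback f d)
  have hmono := mono_comm₀Map_of_isPullback P sq₂ (mono_comm₀Map_of_isTrivialExtension P _ htriv)
  let t : D' ⟶ E := pullback.lift (c ≫ s) (𝟙 _) (by simp [hs])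
  have ht : comm₀Map P t ≫ comm₀Map P (pullback.snd g c) = 𝟙 _ := by
    rw [← comm₀Map_comp, ← comm₀Map_id]
    simp [t, pullback.lift_snd]
  have hsplit : IsSplitEpi (comm₀Map P (pullback.snd g c)) := ⟨⟨⟨_, ht⟩⟩⟩
  have hiso : IsIso (comm₀Map P (pullback.snd g c)) := isIso_of_mono_of_isSplitEpi _
  have : IsIso (comm₀Map P t ≫ comm₀Map P (pullback.snd g c)) := ht ▸ inferInstance
  have hiso' : IsIso (comm₀Map P t) :=
    IsIso.of_isIso_comp_right _ (comm₀Map P (pullback.snd g c))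
  have hfst := isRegularEpi_comm₀Map P (pullback.fst g c) inferInstance
  have hs' : comm₀Map P s ≫ comm₀Map P g = 𝟙 _ := by rw [← comm₀Map_comp, hs, comm₀Map_id]
  have : StrongEpi (comm₀Map P s) := by
    have h₁ : comm₀Map P c ≫ comm₀Map P s = comm₀Map P t ≫ comm₀Map P (pullback.fst g c) := by
      simp only [← comm₀Map_comp]
      simp [t, pullback.lift_fst]
    have : StrongEpi (comm₀Map P c ≫ comm₀Map P s) := h₁ ▸ strongEpi_comp _ _
    exact strongEpi_of_strongEpi (comm₀Map P c) _
  have : IsSplitMono (comm₀Map P s) := ⟨⟨⟨_, hs'⟩⟩⟩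
  have hsi : IsIso (comm₀Map P s) := isIso_of_mono_of_strongEpi _
  have : IsIso (comm₀Map P s ≫ comm₀Map P g) := hs' ▸ inferInstance
  exact ⟨hsi, IsIso.of_isIso_comp_left (comm₀Map P s) _⟩

theorem isCentralExtension_iff {B A : C} (f : B ⟶ A) : IsCentralExtension P f ↔
    IsRegularEpi f ∧ Mono (comm₀Map P (pullback.snd f f)) := by
  refine ⟨fun hf => ⟨hf.1, ?_⟩, fun ⟨hf, h⟩ => ⟨hf, _, f, hf, ?_⟩⟩
  · have := (isIso_comm₀Map_of_isPullback_of_section P (IsPullback.of_hasPullback f f) hf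
      (pullback.diagonal f) (by simp)).2
    infer_instance
  · exact isTrivialExtension_of_mono P _ inferInstance h

theorem mono_comm₀Map_fst_of_isCentralExtension {B A : C} (f : B ⟶ A)
    (hf : IsCentralExtension P f) : Mono (comm₀Map P (pullback.fst f f)) := by
  have := (isIso_comm₀Map_of_isPullback_of_section P (IsPullback.of_hasPullback f f).flip hf
    (pullback.diagonal f) (by simp)).2
  infer_instance

theorem isCentralExtension_of_isTrivialExtension {B A : C} (f : B ⟶ A)
    (hf : IsRegularEpi f) (h : Mono (comm₀Map P f)) : IsCentralExtension P f :=
  (isCentralExtension_iff P f).2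
    ⟨hf, mono_comm₀Map_of_isPullback P (IsPullback.of_hasPullback f f) h⟩

/-- The kernel pair of `g` is itself a pullback of `f`, split by the diagonal. -/
theorem isCentralExtension_of_isPullback {B A D E : C} {a : E ⟶ B} {g : E ⟶ D} {f : B ⟶ A}
    {h : D ⟶ A} (sq : IsPullback a g f h) (hf : IsCentralExtension P f) :
    IsCentralExtension P g := by
  refine (isCentralExtension_iff P g).2 ⟨isRegularEpi_of_isPullback sq hf.1, ?_⟩
  have := (isIso_comm₀Map_of_isPullback_of_section P
    ((IsPullback.of_hasPullback g g).paste_horiz sq) hf (pullback.diagonal g) (by simp)).2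
  infer_instance

/-! ### Perfect objects -/

theorem isPerfect_iff (X : C) : IsPerfect P X ↔ IsZero ((refl P).obj X) := by
  refine ⟨?_, fun h => ⟨_, _, isReflection_unit P X, h⟩⟩
  rintro ⟨Y, η, h, hY⟩
  have hη : (unit P).app X = 0 := by
    obtain ⟨l, hl, -⟩ := h.existsUnique (isReflection_unit P X).prop ((unit P).app X)
    rw [← hl, hY.eq_zero_of_src l, comp_zero]
  have := isRegularEpi_unit P X
  rw [IsZero.iff_id_eq_zero, ← cancel_epi ((unit P).app X), hη, zero_comp, zero_comp]

theorem isIso_μ_of_isPerfect {X : C} (h : IsPerfect P X) : IsIso (μ P X) := by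
  have : (unit P).app X = 0 := ((isPerfect_iff P X).1 h).eq_zero_of_tgt _
  exact ⟨kernel.lift _ (𝟙 X) (by simp [this]), by
    rw [← cancel_mono (μ P X)]; simp, by simp⟩

theorem isPerfect_of_epi_μ {X : C} (h : Epi (μ P X)) : IsPerfect P X := by
  have hη : (unit P).app X = 0 := by
    rw [← cancel_epi (μ P X), kernel.condition, comp_zero]
  have := isRegularEpi_unit P X
  rw [isPerfect_iff, IsZero.iff_id_eq_zero, ← cancel_epi ((unit P).app X), hη, zero_comp,
    zero_comp]

theorem eq_zero_of_isPerfect {X Z : C} (h : IsPerfect P X) (hZ : P Z) (g : X ⟶ Z) : g = 0 := by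
  have := isIso_μ_of_isPerfect P h
  rw [← cancel_epi (μ P X), μ_comp_eq_zero P hZ, comp_zero]

/-- There is at most one morphism over `A` from a perfect object to a central extension. -/
theorem eq_of_isPerfect {U B A : C} (hU : IsPerfect P U) (f : B ⟶ A)
    (hf : IsCentralExtension P f) (g g' : U ⟶ B) (h : g ≫ f = g' ≫ f) : g = g' := by
  have := isIso_μ_of_isPerfect P hU
  have := mono_comm₀Map_fst_of_isCentralExtension P f hf
  -- The pairs (g, g') and (g, g) share their first coordinate, and the first projection is mono on
  -- commutators.
  have key : comm₀Map P (pullback.lift g g' h) = comm₀Map P (pullback.lift g g rfl) := by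
    rw [← cancel_mono (comm₀Map P (pullback.fst f f)), ← comm₀Map_comp, ← comm₀Map_comp,
      pullback.lift_fst, pullback.lift_fst]
  have := key =≫ μ P _ ≫ pullback.snd f f
  simp only [comm₀Map_μ_assoc, pullback.lift_snd] at this
  exact ((cancel_epi _).1 this).symm

/-! ### Perfect central extensions found inside a central extension -/

/-- The commutator of a central extension `e : E ⟶ U` is detected on any `m : M ⟶ E` whose
composite with `e` is a regular epimorphism. -/
theorem isRegularEpi_comm₀Map_of_comp {M E U : C} (m : M ⟶ E) (e : E ⟶ U)
    (he : IsCentralExtension P e) (hme : IsRegularEpi (m ≫ e)) :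
    IsRegularEpi (comm₀Map P m) := by
  let s : M ⟶ pullback e (m ≫ e) := pullback.lift m (𝟙 M) (by simp)
  have := (isIso_comm₀Map_of_isPullback_of_section P (IsPullback.of_hasPullback e (m ≫ e)) he s
    (pullback.lift_snd _ _ _)).1
  have h : comm₀Map P s ≫ comm₀Map P (pullback.fst e (m ≫ e)) = comm₀Map P m := by
    rw [← comm₀Map_comp, pullback.lift_fst]
  rw [← h]
  exact isRegularEpi_comp _ _ inferInstance (isRegularEpi_comm₀Map P _ inferInstance)

/-- Applying the functor to the inclusion of [E,E] in `E` gives the inclusion of the commutator of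
[E,E], which is thus a cover. -/
theorem isPerfect_comm₀ {E U : C} (e : E ⟶ U) (he : IsCentralExtension P e)
    (h : IsRegularEpi (μ P E ≫ e)) : IsPerfect P (comm₀ P E) := by
  refine isPerfect_of_epi_μ P ?_
  have : comm₀Map P (μ P E) = μ P (comm₀ P E) := by
    rw [← cancel_mono (μ P E), comm₀Map_μ]
  have h' := isRegularEpi_comm₀Map_of_comp P (μ P E) e he h
  rw [← this]
  infer_instance

/-- Subobjects of central extensions are central. -/
theorem isCentralExtension_of_mono {M E U : C} (m : M ⟶ E) [Mono m] (e : E ⟶ U)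
    (he : IsCentralExtension P e) (hme : IsRegularEpi (m ≫ e)) : IsCentralExtension P (m ≫ e) := by
  refine (isCentralExtension_iff P _).2 ⟨hme, ⟨fun x y hxy => ?_⟩⟩
  have := ((isCentralExtension_iff P e).1 he).2
  let d : pullback (m ≫ e) (m ≫ e) ⟶ pullback e e :=
    pullback.map _ _ _ _ m m (𝟙 U) (by simp) (by simp)
  have hd₁ : d ≫ pullback.fst e e = pullback.fst _ _ ≫ m := pullback.lift_fst _ _ _
  have hd₂ : d ≫ pullback.snd e e = pullback.snd _ _ ≫ m := pullback.lift_snd _ _ _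
  have key : x ≫ comm₀Map P d = y ≫ comm₀Map P d := by
    rw [← cancel_mono (comm₀Map P (pullback.snd e e)), Category.assoc, Category.assoc,
      ← comm₀Map_comp, hd₂, comm₀Map_comp, reassoc_of% hxy]
  have key' := key =≫ μ P _
  simp only [Category.assoc, comm₀Map_μ] at key'
  rw [← cancel_mono (μ P _)]
  apply pullback.hom_ext
  · rw [← cancel_mono m]
    simpa [hd₁] using key' =≫ pullback.fst e e
  · rw [← cancel_mono m]
    simpa [hd₂] using key' =≫ pullback.snd e e

end Extensions

/-! ### Abelian objects -/

section Abelian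

open CartesianMonoidalCategory MonoidalCategory

variable {C : Type u} [Category.{v} C] [HasZeroMorphisms C] [SemiAbelian C]

section

variable [CartesianMonoidalCategory C]

theorem kernel_ι_fst (X Y : C) :
    kernel.ι (fst X Y) = (kernel.ι (fst X Y) ≫ snd X Y) ≫ lift 0 (𝟙 Y) := by
  ext <;> simp

/-- Morphisms from a product are determined by their restrictions to the factors. -/
theorem tensor_hom_ext_of_axes {X Y W : C} (φ ψ : X ⊗ Y ⟶ W)
    (h₁ : lift (𝟙 X) 0 ≫ φ = lift (𝟙 X) 0 ≫ ψ) (h₂ : lift 0 (𝟙 Y) ≫ φ = lift 0 (𝟙 Y) ≫ ψ) :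
    φ = ψ := by
  refine eq_of_section_of_kernel (fst X Y) (lift (𝟙 X) 0) (by simp) _ _ h₁ ?_
  rw [kernel_ι_fst, Category.assoc _ _ φ, h₂, Category.assoc _ _ ψ]

/-- Unital magmas are abelian groups. -/
theorem exists_grpObj_isCommMonObj_of_unital [BraidedCategory C] {Z : C} (m : Z ⊗ Z ⟶ Z)
    (h₁ : lift (𝟙 Z) 0 ≫ m = 𝟙 Z) (h₂ : lift 0 (𝟙 Z) ≫ m = 𝟙 Z) :
    ∃ _ : GrpObj Z, IsCommMonObj Z := by
  have h₁' : ∀ {T : C} (t : T ⟶ Z), lift t 0 ≫ m = t := fun {T} t => by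
    have : lift t (0 : T ⟶ Z) = t ≫ lift (𝟙 Z) 0 := by ext <;> simp
    rw [this, Category.assoc, h₁, Category.comp_id]
  have h₂' : ∀ {T : C} (t : T ⟶ Z), lift 0 t ≫ m = t := fun {T} t => by
    have : lift (0 : T ⟶ Z) t = t ≫ lift 0 (𝟙 Z) := by ext <;> simp
    rw [this, Category.assoc, h₂, Category.comp_id]
  have comm : lift (snd Z Z) (fst Z Z) ≫ m = m := by
    apply tensor_hom_ext_of_axes
    · rw [h₁, comp_lift_assoc, lift_fst, lift_snd, h₂']
    · rw [h₂, comp_lift_assoc, lift_fst, lift_snd, h₁']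
  have assoc : lift (lift (fst Z (Z ⊗ Z)) (snd Z (Z ⊗ Z) ≫ fst Z Z) ≫ m)
      (snd Z (Z ⊗ Z) ≫ snd Z Z) ≫ m = lift (fst Z (Z ⊗ Z)) (snd Z (Z ⊗ Z) ≫ m) ≫ m := by
    apply tensor_hom_ext_of_axes
    · simp [comp_lift_assoc, h₁']
    · simp [comp_lift_assoc, h₂']
  -- The shear (x, y) ↦ (x, xy) is invertible by the Short Five Lemma; the inverse of x is the y
  -- with xy = 0.
  let φ : Z ⊗ Z ⟶ Z ⊗ Z := lift (fst Z Z) m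
  have hφ : IsIso φ := by
    have hs : IsSplitEpi (fst Z Z) := ⟨⟨⟨lift (𝟙 Z) 0, by simp⟩⟩⟩
    refine SemiAbelian.short_five (fst Z Z) (fst Z Z) φ (𝟙 Z) (by simp [φ]) inferInstance
      inferInstance ?_ inferInstance
    have : kernel.map (fst Z Z) (fst Z Z) φ (𝟙 Z) (by simp [φ]) = 𝟙 _ := by
      rw [← cancel_mono (kernel.ι (fst Z Z)), kernel.map, kernel.lift_ι, kernel_ι_fst]
      simp [φ, h₂']
    rw [this]
    infer_instance
  have hφ₁ : inv φ ≫ fst Z Z = fst Z Z := by simp [φ]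
  have hφ₂ : inv φ ≫ m = snd Z Z := by simp [φ]
  let i : Z ⟶ Z := lift (𝟙 Z) 0 ≫ inv φ ≫ snd Z Z
  have hi : lift (𝟙 Z) i = lift (𝟙 Z) 0 ≫ inv φ := by
    ext <;> simp [i, hφ₁]
  have hri : lift (𝟙 Z) i ≫ m = 0 := by
    rw [hi, Category.assoc, hφ₂, lift_snd]
  have hli : lift i (𝟙 Z) ≫ m = 0 := by
    rw [← hri]
    conv_lhs => rw [← comm, comp_lift_assoc, lift_fst, lift_snd]
  let G : GrpObj Z :=
    { one := 0
      mul := m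
      one_mul := by
        have : (0 : 𝟙_ C ⟶ Z) ▷ Z = lift 0 (snd _ _) := by ext <;> simp
        rw [this, h₂', leftUnitor_hom]
      mul_one := by
        have : Z ◁ (0 : 𝟙_ C ⟶ Z) = lift (fst _ _) 0 := by ext <;> simp
        rw [this, h₁', rightUnitor_hom]
      mul_assoc := by
        have e₁ : m ▷ Z = (α_ Z Z Z).hom ≫
            lift (lift (fst Z (Z ⊗ Z)) (snd Z (Z ⊗ Z) ≫ fst Z Z) ≫ m)
              (snd Z (Z ⊗ Z) ≫ snd Z Z) := by
          have : (α_ Z Z Z).hom ≫ lift (fst Z (Z ⊗ Z)) (snd Z (Z ⊗ Z) ≫ fst Z Z) =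
              fst (Z ⊗ Z) Z := by
            ext <;> simp
          ext <;> simp [reassoc_of% this]
        have e₂ : Z ◁ m = lift (fst Z (Z ⊗ Z)) (snd Z (Z ⊗ Z) ≫ m) := by ext <;> simp
        rw [e₁, e₂, Category.assoc, assoc]
      inv := i
      left_inv := by rw [hli, comp_zero]
      right_inv := by rw [hri, comp_zero] }
  refine ⟨G, ⟨?_⟩⟩
  have : (β_ Z Z).hom = lift (snd Z Z) (fst Z Z) := by ext <;> simp
  rw [this]
  exact comm

end

theorem abelianObjects_of_unital {Z : C} (m : Z ⨯ Z ⟶ Z)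
    (h₁ : prod.lift (𝟙 Z) 0 ≫ m = 𝟙 Z) (h₂ : prod.lift 0 (𝟙 Z) ≫ m = 𝟙 Z) :
    abelianObjects C Z := by
  let _ : CartesianMonoidalCategory C := CartesianMonoidalCategory.ofHasFiniteProducts
  let _ : BraidedCategory C := BraidedCategory.ofCartesianMonoidalCategory
  refine exists_grpObj_isCommMonObj_of_unital (prod.lift (fst Z Z) (snd Z Z) ≫ m) ?_ ?_
  · have : lift (𝟙 Z) 0 ≫ prod.lift (fst Z Z) (snd Z Z) = prod.lift (𝟙 Z) 0 := by
      ext <;> simp [prod.lift_fst, prod.lift_snd]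
    rw [reassoc_of% this, h₁]
  · have : lift 0 (𝟙 Z) ≫ prod.lift (fst Z Z) (snd Z Z) = prod.lift 0 (𝟙 Z) := by
      ext <;> simp [prod.lift_fst, prod.lift_snd]
    rw [reassoc_of% this, h₂]

theorem abelianObjects_of_isZero {Z : C} (hZ : IsZero Z) : abelianObjects C Z :=
  abelianObjects_of_unital 0 (hZ.eq_of_src _ _) (hZ.eq_of_src _ _)

variable (P : ObjectProperty C) [IsBirkhoff P]

theorem isPerfect_abelianObjects (hP : abelianObjects C ≤ P) {X : C} (h : IsPerfect P X) :
    IsPerfect (abelianObjects C) X := by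
  have hz : IsZero ((refl P).obj X) := (isPerfect_iff P X).1 h
  exact ⟨_, _, ⟨abelianObjects_of_isZero hz, fun Z hZ =>
    (isReflection_unit P X).existsUnique (hP Z hZ)⟩, hz⟩

/-- A pullback square over a reflection in Ab(C) gives joint monicity with a map into `P`, which is
all that triviality for `P` needs. -/
theorem isCentralExtension_of_abelianObjects (hP : abelianObjects C ≤ P) {B A : C} (f : B ⟶ A)
    (hf : IsCentralExtension (abelianObjects C) f) : IsCentralExtension P f := by
  obtain ⟨hf, D, g, hg, hs, B', A', ηB, ηA, f', hB, hA, sq⟩ := hf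
  exact ⟨hf, D, g, hg, isTrivialExtension_of_mono P _ hs <|
    mono_comm₀Map_of_jointly P _ ηB (hP _ hB.prop) fun _ _ _ h₁ h₂ => sq.hom_ext h₁ h₂⟩

/-- Central extensions with perfect domain are `Ab(C)`-central. -/
theorem isCentralExtension_abelianObjects (hP : abelianObjects C ≤ P) {B A : C} (f : B ⟶ A)
    (hf : IsCentralExtension P f) (hB : IsPerfect P B) :
    IsCentralExtension (abelianObjects C) f := by
  have htriv : IsTrivialExtension P (pullback.snd f f) :=
    have := hf.1
    isTrivialExtension_of_mono P _ inferInstance ((isCentralExtension_iff P f).1 hf).2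
  obtain ⟨hs, sq⟩ := (isTrivialExtension_iff P _).1 htriv
  have hz : IsZero ((refl P).obj B) := (isPerfect_iff P B).1 hB
  -- As the reflection of `B` is zero, triviality says that `R` is the product of `B` and `Z`, with
  -- `j` the inclusion of `Z`; it remains to make `Z` abelian.
  let R := pullback f f
  let Z := (refl P).obj R
  let ζ : R ⟶ Z := (unit P).app R
  have hRζ := isReflection_unit P R
  let j : Z ⟶ R := sq.lift 0 (𝟙 Z) (hz.eq_of_tgt _ _)
  have j₁ : j ≫ pullback.snd f f = 0 := sq.lift_fst _ _ _
  have j₂ : j ≫ ζ = 𝟙 Z := sq.lift_snd _ _ _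
  let k : Z ⟶ B := j ≫ pullback.fst f f
  have hk : k ≫ f = 0 := by
    rw [Category.assoc, pullback.condition, reassoc_of% j₁, zero_comp]
  have hj : j = pullback.lift k 0 (by simp [hk]) := by
    apply pullback.hom_ext
    · rw [pullback.lift_fst]
    · rw [pullback.lift_snd, j₁]
  -- v(x, y) is the element of `R` with second coordinate k x and `Z`-component y. Its first
  -- coordinate w lies in the kernel of `f`, and the sum of x and y is the `Z`-component of (w, 0).
  let v : Z ⨯ Z ⟶ R := sq.lift (prod.fst ≫ k) prod.snd (hz.eq_of_tgt _ _)
  have v₁ : v ≫ pullback.snd f f = prod.fst ≫ k := sq.lift_fst _ _ _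
  have v₂ : v ≫ ζ = prod.snd := sq.lift_snd _ _ _
  have hv : (v ≫ pullback.fst f f) ≫ f = 0 ≫ f := by
    rw [Category.assoc, pullback.condition, reassoc_of% v₁, hk, comp_zero, zero_comp]
  -- The diagonal has zero `Z`-component because `B` is perfect.
  have v₃ : prod.lift (𝟙 Z) 0 ≫ v = k ≫ pullback.diagonal f := by
    refine sq.hom_ext ?_ ?_
    · rw [Category.assoc, v₁]
      simp [prod.lift_fst_assoc]
    · change (_ ≫ v) ≫ ζ = _ ≫ ζ
      rw [Category.assoc, v₂, Category.assoc,
        eq_zero_of_isPerfect P hB hRζ.prop (pullback.diagonal f ≫ ζ), comp_zero, prod.lift_snd]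
  have v₄ : prod.lift 0 (𝟙 Z) ≫ v = j := by
    refine sq.hom_ext ?_ ?_
    · rw [Category.assoc, v₁, j₁, prod.lift_fst_assoc, zero_comp]
    · change (_ ≫ v) ≫ ζ = j ≫ ζ
      rw [Category.assoc, v₂, j₂, prod.lift_snd]
  have hZ : abelianObjects C Z := by
    refine abelianObjects_of_unital (pullback.lift (v ≫ pullback.fst f f) 0 hv ≫ ζ) ?_ ?_
    · have : prod.lift (𝟙 Z) 0 ≫ pullback.lift (v ≫ pullback.fst f f) 0 hv = j := by
        rw [hj]
        apply pullback.hom_ext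
        · rw [Category.assoc, pullback.lift_fst, pullback.lift_fst, reassoc_of% v₃]
          simp
        · rw [Category.assoc, pullback.lift_snd, pullback.lift_snd, comp_zero]
      rw [reassoc_of% this, j₂]
    · have : prod.lift 0 (𝟙 Z) ≫ pullback.lift (v ≫ pullback.fst f f) 0 hv = j := by
        apply pullback.hom_ext
        · rw [Category.assoc, pullback.lift_fst, reassoc_of% v₄]
        · rw [Category.assoc, pullback.lift_snd, j₁, comp_zero]
      rw [reassoc_of% this, j₂]
  exact ⟨hf.1, B, f, hf.1, hs, Z, _, ζ, _, _, ⟨hZ, fun Y hY => hRζ.existsUnique (hP Y hY)⟩,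
    ⟨abelianObjects_of_isZero hz, fun Y hY =>
      (isReflection_unit P B).existsUnique (hP Y hY)⟩, sq⟩

end Abelian

/-! ### The Hopf formula -/

section Hopf

variable {C : Type u} [Category.{v} C] [HasZeroMorphisms C] [SemiAbelian C]
  (P : ObjectProperty C) [IsBirkhoff P]

/-- The commutator `[K,F]_P` vanishes in central extensions. -/
theorem comm₁ι_comp_comm₀Map {F V U : C} (p : F ⟶ U) (t : F ⟶ V) (g : V ⟶ U)
    (hg : IsCentralExtension P g) (ht : t ≫ g = p) : comm₁ι P p ≫ comm₀Map P t = 0 := by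
  have := mono_comm₀Map_fst_of_isCentralExtension P g hg
  let d : pullback p p ⟶ pullback g g :=
    pullback.map _ _ _ _ t t (𝟙 U) (by simp [ht]) (by simp [ht])
  have hd₁ : d ≫ pullback.fst g g = pullback.fst _ _ ≫ t := pullback.lift_fst _ _ _
  have hd₂ : d ≫ pullback.snd g g = pullback.snd _ _ ≫ t := pullback.lift_snd _ _ _
  have key : kernel.ι (comm₀Map P (pullback.fst p p)) ≫ comm₀Map P d = 0 := by
    rw [← cancel_mono (comm₀Map P (pullback.fst g g)), Category.assoc, ← comm₀Map_comp, hd₁,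
      comm₀Map_comp, kernel.condition_assoc, zero_comp, zero_comp]
  rw [comm₁ι, Category.assoc, ← comm₀Map_comp, ← hd₂, comm₀Map_comp, reassoc_of% key, zero_comp]

/-- The centralization `F / [K,F]_P ⟶ U` of a regular epimorphism `p : F ⟶ U` with
kernel `K`. -/
theorem exists_centralization {F U : C} (p : F ⟶ U) (hp : IsRegularEpi p) :
    ∃ (E : C) (q : F ⟶ E) (e : E ⟶ U), IsRegularEpi q ∧ q ≫ e = p ∧ IsCentralExtension P e ∧
      ∀ ⦃T : C⦄ (t : T ⟶ F), t ≫ q = 0 → ∃ (T' : C) (c : T' ⟶ T) (s : T' ⟶ comm₁ P p),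
        IsRegularEpi c ∧ s ≫ comm₁ι P p ≫ μ P F = c ≫ t := by
  -- The kernel of `h` is the part of the commutator of the kernel pair with zero first coordinate,
  -- that is [K,F]; `q` divides `F` by its image under the second projection.
  let h := prod.lift (pullback.fst p p) ((unit P).app (pullback p p))
  obtain ⟨E, q, hq, hq₁, hq₂⟩ := exists_quotient_of_image (pullback.snd p p) inferInstance h
  have hcov : ∀ ⦃T : C⦄ (t : T ⟶ F), t ≫ q = 0 →
      ∃ (T' : C) (c : T' ⟶ T) (s : T' ⟶ comm₁ P p),
        IsRegularEpi c ∧ s ≫ comm₁ι P p ≫ μ P F = c ≫ t := by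
    intro T t ht
    obtain ⟨T', c, s, hc, hs⟩ := hq₂ t ht
    have h₁ : kernel.ι h ≫ pullback.fst p p = 0 := by
      have := kernel.condition h =≫ prod.fst
      simpa only [h, Category.assoc, prod.lift_fst, zero_comp] using this
    have h₂ : kernel.ι h ≫ (unit P).app (pullback p p) = 0 := by
      have := kernel.condition h =≫ prod.snd
      simpa only [h, Category.assoc, prod.lift_snd, zero_comp] using this
    have h₃ : kernel.lift _ _ h₂ ≫ comm₀Map P (pullback.fst p p) = 0 := by
      rw [← cancel_mono (μ P F), Category.assoc, comm₀Map_μ, kernel.lift_ι_assoc, h₁, zero_comp]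
    refine ⟨T', c, s ≫ kernel.lift _ _ h₃, hc, ?_⟩
    rw [← hs]
    simp [comm₁ι]
  have hkill : comm₁ι P p ≫ μ P F ≫ q = 0 := by
    have := hq₁ (kernel.ι (comm₀Map P (pullback.fst p p)) ≫ μ P _) 0 (by
      apply prod.hom_ext
      · simp only [h, Category.assoc, prod.lift_fst, zero_comp]
        rw [← comm₀Map_μ, kernel.condition_assoc, zero_comp]
      · simp only [h, Category.assoc, prod.lift_snd, zero_comp]
        rw [kernel.condition, comp_zero])
    simpa [comm₁ι] using this
  obtain ⟨e, he⟩ : ∃ e, q ≫ e = p := by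
    refine exists_desc_of_kernel q hq p ?_
    obtain ⟨T', c, s, hc, hs⟩ := hcov (kernel.ι q) (kernel.condition q)
    rw [← cancel_epi c, ← reassoc_of% hs, ← Category.assoc (comm₁ι P p), comm₁ι_condition,
      comp_zero, comp_zero]
  have hereg : IsRegularEpi e := isRegularEpi_of_comp q e (he ▸ hp)
  refine ⟨E, q, e, hq, he, ?_, hcov⟩
  have hmono : Mono (comm₀Map P (pullback.fst e e)) := by
    refine mono_of_forall_eq_zero _ fun T x hx => ?_
    let d : pullback p p ⟶ pullback e e :=
      pullback.map p p e e q q (𝟙 U) (by simp [he]) (by simp [he])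
    have hd₁ : d ≫ pullback.fst e e = pullback.fst _ _ ≫ q := pullback.lift_fst _ _ _
    have hd₂ : d ≫ pullback.snd e e = pullback.snd _ _ ≫ q := pullback.lift_snd _ _ _
    obtain ⟨T', c, y, hc, hy⟩ := exists_cover_lift _
      (isRegularEpi_comm₀Map P d (isRegularEpi_kernelPair_map q e p he hq)) x
    have hy₁ : (y ≫ comm₀Map P (pullback.fst p p) ≫ μ P F) ≫ q = 0 := by
      have : y ≫ comm₀Map P d ≫ comm₀Map P (pullback.fst e e) ≫ μ P E = 0 := by
        rw [reassoc_of% hy, reassoc_of% hx, zero_comp, comp_zero]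
      simpa [hd₁] using this
    obtain ⟨T'', c', s, hc', hs⟩ := hcov _ hy₁
    have hs' : (c' ≫ y) ≫ comm₀Map P (pullback.fst p p) = s ≫ comm₁ι P p := by
      rw [← cancel_mono (μ P F)]
      simpa using hs.symm
    -- `Y` consists of the commutator elements of the kernel pair whose first coordinate lies in
    -- [K,F]. Their second coordinate dies in `E`: this holds on the diagonal, and for first
    -- coordinate zero it is the definition of [K,F].
    let Y := pullback (comm₀Map P (pullback.fst p p)) (comm₁ι P p)
    let π : Y ⟶ comm₁ P p := pullback.snd _ _
    let σ : comm₁ P p ⟶ Y := pullback.lift (comm₁ι P p ≫ comm₀Map P (pullback.diagonal p)) (𝟙 _)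
      (by rw [Category.assoc, ← comm₀Map_comp]; simp [comm₀Map_id])
    have hψ : pullback.fst _ _ ≫ μ P _ ≫ pullback.snd p p ≫ q = (0 : Y ⟶ E) := by
      refine eq_of_section_of_kernel π σ (pullback.lift_snd _ _ _) _ _ ?_ ?_
      · simp [σ, pullback.lift_fst_assoc, hkill]
      · have hl : (kernel.ι π ≫ pullback.fst _ _) ≫ comm₀Map P (pullback.fst p p) = 0 := by
          rw [Category.assoc, pullback.condition, kernel.condition_assoc, zero_comp]
        have := kernel.lift _ _ hl ≫= hkill
        rw [comp_zero, ← Category.assoc]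
        simpa [comm₁ι] using this
    have hy₂ := pullback.lift _ _ hs' ≫= hψ
    rw [pullback.lift_fst_assoc, comp_zero] at hy₂
    rw [← cancel_epi (c' ≫ c), ← cancel_mono (μ P _)]
    apply pullback.hom_ext
    · have := hx =≫ μ P E
      simp only [Category.assoc, comm₀Map_μ, zero_comp] at this
      simp [this]
    · simp only [Category.assoc, zero_comp, comp_zero] at hy₂ ⊢
      rw [← reassoc_of% hy, comm₀Map_μ_assoc, hd₂, hy₂]
  refine (isCentralExtension_iff P e).2 ⟨hereg, ?_⟩
  exact mono_comm₀Map_of_isPullback P (a := (pullbackSymmetry e e).hom) (h := 𝟙 E)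
    (IsPullback.of_horiz_isIso ⟨by simp⟩) hmono

/-- A central extension of a perfect object with vanishing second homology splits. -/
theorem exists_section_of_isZero_H₂ {U V F : C} (hU : IsPerfect P U) (g : V ⟶ U)
    (hg : IsCentralExtension P g) (p : F ⟶ U) (hp : IsProjectivePresentation p)
    (h : IsZero (H₂ P p)) : ∃ s : U ⟶ V, s ≫ g = 𝟙 U := by
  obtain ⟨t, ht⟩ := hp.projective g hg.1 p
  have := isIso_μ_of_isPerfect P hU
  have hc : comm₁ToKerMeet P p ≫ pullback.snd (kernel.ι p) (μ P F) = comm₁ι P p :=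
    pullback.lift_snd _ _ _
  have hk : pullback.snd (kernel.ι p) (μ P F) ≫ comm₀Map P t = 0 := by
    have := cokernel.π_desc (comm₁ToKerMeet P p)
      (pullback.snd (kernel.ι p) (μ P F) ≫ comm₀Map P t) (by
        rw [reassoc_of% hc, comm₁ι_comp_comm₀Map P p t g hg ht])
    have hz : cokernel.π (comm₁ToKerMeet P p) = 0 := h.eq_zero_of_tgt _
    rw [← this, hz, zero_comp]
  have hπ : IsRegularEpi (comm₀Map P p ≫ μ P U) :=
    isRegularEpi_comp _ _ (isRegularEpi_comm₀Map P p hp.regularEpi) inferInstance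
  obtain ⟨s, hs⟩ := exists_desc_of_kernel _ hπ (comm₀Map P t ≫ μ P V) (by
    have hκ : (kernel.ι (comm₀Map P p ≫ μ P U) ≫ μ P F) ≫ p = 0 := by
      rw [Category.assoc, ← comm₀Map_μ, kernel.condition]
    have := pullback.lift (kernel.lift p _ hκ) (kernel.ι (comm₀Map P p ≫ μ P U)) (by simp) ≫= hk
    rw [pullback.lift_snd_assoc, comp_zero] at this
    rw [reassoc_of% this, zero_comp])
  refine ⟨s, ?_⟩
  rw [← cancel_epi (comm₀Map P p ≫ μ P U), ← Category.assoc, hs]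
  simp [ht]

/-! ### The two implications -/

theorem isUniversalCentralExtension_of_isZero {U A F : C} (u : U ⟶ A)
    (hu : IsCentralExtension P u) (p : F ⟶ U) (hp : IsProjectivePresentation p)
    (h₁ : IsZero (H₁ P U)) (h₂ : IsZero (H₂ P p)) : IsUniversalCentralExtension P u := by
  have hU : IsPerfect P U := (isPerfect_iff P U).2 h₁
  refine ⟨hu, fun B f hf => ?_⟩
  obtain ⟨s, hs⟩ := exists_section_of_isZero_H₂ P hU (pullback.snd f u)
    (isCentralExtension_of_isPullback P (IsPullback.of_hasPullback f u) hf) p hp h₂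
  refine ⟨s ≫ pullback.fst f u, ?_, fun g hg => eq_of_isPerfect P hU f hf _ _ ?_⟩
  · simp [pullback.condition, reassoc_of% hs]
  · simp [pullback.condition, reassoc_of% hs, hg]

/-- The projection A × I(U) → A is trivial, so (u, η) and (u, 0) coincide as maps over `A`, forcing
η = 0. -/
theorem isPerfect_of_isUniversalCentralExtension {U A : C} (u : U ⟶ A)
    (hu : IsUniversalCentralExtension P u) : IsPerfect P U := by
  let Z := (refl P).obj U
  have hs : IsSplitEpi (prod.fst : A ⨯ Z ⟶ A) := ⟨⟨⟨prod.lift (𝟙 A) 0, prod.lift_fst _ _⟩⟩⟩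
  have hc : IsCentralExtension P (prod.fst : A ⨯ Z ⟶ A) :=
    isCentralExtension_of_isTrivialExtension P _ inferInstance
      (mono_comm₀Map_of_jointly P _ prod.snd (isReflection_unit P U).prop
        fun _ _ _ h₁ h₂ => prod.hom_ext h₁ h₂)
  have key := (hu.2 _ hc).unique (y₁ := prod.lift u ((unit P).app U)) (y₂ := prod.lift u 0)
    (prod.lift_fst _ _) (prod.lift_fst _ _) =≫ prod.snd
  rw [prod.lift_snd, prod.lift_snd] at key
  have := isRegularEpi_unit P U
  rw [isPerfect_iff, IsZero.iff_id_eq_zero, ← cancel_epi ((unit P).app U), key, zero_comp,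
    zero_comp]

theorem isZero_H₂_of_isUniversalCentralExtension (hUCE : ConditionUCE C)
    (hP : abelianObjects C ≤ P) {U A F : C} (u : U ⟶ A) (hu : IsUniversalCentralExtension P u)
    (p : F ⟶ U) (hp : IsRegularEpi p) : IsZero (H₂ P p) := by
  have hU := isPerfect_of_isUniversalCentralExtension P u hu
  have := isIso_μ_of_isPerfect P hU
  obtain ⟨E, q, e, hq, hqe, he, hcov⟩ := exists_centralization P p hp
  let w := μ P E ≫ e
  have hw : IsRegularEpi w := by
    refine isRegularEpi_of_comp (comm₀Map P q) _ ?_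
    have : comm₀Map P q ≫ w = comm₀Map P p ≫ μ P U := by simp [w, hqe]
    rw [this]
    exact isRegularEpi_comp _ _ (isRegularEpi_comm₀Map P p hp) inferInstance
  have hW : IsPerfect P (comm₀ P E) := isPerfect_comm₀ P e he hw
  have hwc : IsCentralExtension P w := isCentralExtension_of_mono P (μ P E) e he hw
  have hwu : IsCentralExtension P (w ≫ u) := isCentralExtension_of_abelianObjects P hP _ <|
    hUCE w u (isPerfect_abelianObjects P hP hU) (isCentralExtension_abelianObjects P hP u hu.1 hU)
      (isCentralExtension_abelianObjects P hP w hwc hW)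
  obtain ⟨s, hs, -⟩ := hu.2 _ hwu
  have hsw : s ≫ w = 𝟙 U := eq_of_isPerfect P hU u hu.1 _ _ (by simpa using hs)
  have hws : w ≫ s = 𝟙 _ := eq_of_isPerfect P hW w hwc _ _ (by simp [hsw])
  let k := pullback.snd (kernel.ι p) (μ P F)
  have hkp : k ≫ μ P F ≫ p = 0 := by
    rw [← reassoc_of% (pullback.condition (f := kernel.ι p) (g := μ P F)), kernel.condition,
      comp_zero]
  have hkw : (k ≫ comm₀Map P q) ≫ w = 0 := by simpa [w, hqe] using hkp
  have hkq : k ≫ comm₀Map P q = 0 := by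
    rw [← Category.comp_id (k ≫ comm₀Map P q), ← hws, ← Category.assoc, hkw, zero_comp]
  -- On a cover, K ∧ [F,F] factors through [K,F]; so the cokernel projection vanishes on that cover
  -- and hence vanishes.
  obtain ⟨T, c, t, hc, ht⟩ := hcov (k ≫ μ P F) (by
    rw [Category.assoc, ← comm₀Map_μ, reassoc_of% hkq, zero_comp])
  have htc : t ≫ comm₁ToKerMeet P p = c := by
    rw [← cancel_mono k, ← cancel_mono (μ P F), Category.assoc, Category.assoc, Category.assoc,
      ← ht, comm₁ToKerMeet, pullback.lift_snd_assoc]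
  change IsZero (cokernel (comm₁ToKerMeet P p))
  rw [IsZero.iff_id_eq_zero, ← cancel_epi (cokernel.π (comm₁ToKerMeet P p)), ← cancel_epi c,
    ← htc]
  simp

end Hopf

end SemiAb

theorem mainTheorem2 {C : Type u} [Category.{v} C] [HasZeroMorphisms C] [SemiAb.SemiAbelian C]
    (hproj : SemiAb.HasEnoughRegularProjectives C) (hUCE : SemiAb.ConditionUCE C)
    (P : ObjectProperty C) [SemiAb.IsBirkhoff P] (hP : SemiAb.abelianObjects C ≤ P)
    {U A : C} (u : U ⟶ A) (hu : SemiAb.IsCentralExtension P u)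
    {F : C} (p : F ⟶ U) (hp : SemiAb.IsProjectivePresentation p) :
    SemiAb.IsUniversalCentralExtension P u ↔
      IsZero (SemiAb.H₁ P U) ∧ IsZero (SemiAb.H₂ P p) :=
  ⟨fun h => ⟨(SemiAb.isPerfect_iff P U).1
      (SemiAb.isPerfect_of_isUniversalCentralExtension P u h),
    SemiAb.isZero_H₂_of_isUniversalCentralExtension P hUCE hP u h p hp.regularEpi⟩,
  fun h => SemiAb.isUniversalCentralExtension_of_isZero P u hu p hp h.1 h.2⟩
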